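/- Let a group $G$ act on a set $X$. A probability measure $\mu$ on $G$ (viewed as a discrete group, so $\mu=(\mu(g))_{g\in G}$ with $\sum_g\mu(g)=1$) is non-degenerate if its support generates $G$ as a semigroup, and symmetric if $\mu(g^{-1})=\mu(g)$ for all $g$. Put $p_\mu(x,y)=\sum_{g\in G,\ gx=y}\mu(g)$. A function $f:X\to\mathbb{R}$ is $\mu$-harmonic if $f(x)=\sum_{y\in X}f(y)\,p_\mu(x,y)$ for all $x\in X$. The action is Liouville if there is a non-degenerate symmetric probability measure $\mu$ on $G$ such that every bounded $\mu$-harmonic function on $X$ is constant. The action is $n$-Liouville if the induced action of $G$ on the set of all $n$-element subsets of $X$ is Liouville. Let $F_{\mathbb{R}}$ be the group of all piecewise linear homeomorphisms of $\mathbb{R}$ with finitely many breakpoints, all of them dyadic rationals, with all slopes powers of $2$, and which map the set $\mathbb{Z}[1/2]$ of dyadic rationals onto itself. Thompson's group $F$ is the subgroup of those elements of $F_{\mathbb{R}}$ that are the identity outside $[0,1]$. Theorem. The action of $F$ on the dyadic rationals $\mathbb{Z}[1/2]\cap(0,1)$ is $2$-Liouville, and the action of $F_{\mathbb{R}}$ on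 the dyadic rationals $\mathbb{Z}[1/2]$ is $2$-Liouville. -/

import Mathlib

open scoped Topology

namespace ThompsonLiouville

noncomputable section

/-! ### Liouville actions -/

section Liouville

variable {G : Type*} [Group G]

/-- A probability measure on a (discrete) group is non-degenerate if its support generates the
group as a semigroup. -/
def NonDegenerate (μ : PMF G) : Prop :=
  Subsemigroup.closure μ.support = ⊤

/-- A probability measure on a group is symmetric if it is invariant under inversion. -/
def Symmetric (μ : PMF G) : Prop :=
  ∀ g : G, μ g⁻¹ = μ g

/-- The transition probability `p_μ(x, y) = ∑ μ(g)`, the sum being over all `g` with `g x = y`. -/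
def transitionProb {X : Type*} [MulAction G X] (μ : PMF G) (x y : X) : ℝ :=
  ∑' g : {g : G // g • x = y}, (μ g).toReal

/-- `f` is `μ`-harmonic: `f(x) = ∑_y f(y) p_μ(x, y)` for all `x`, with a convergent sum. -/
def IsHarmonic {X : Type*} [MulAction G X] (μ : PMF G) (f : X → ℝ) : Prop :=
  ∀ x : X, HasSum (fun y : X => f y * transitionProb μ x y) (f x)

/-- The action of `G` on `X` is `μ`-Liouville: all bounded `μ`-harmonic functions are constant. -/
def IsLiouvilleFor (X : Type*) [MulAction G X] (μ : PMF G) : Prop :=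
  ∀ f : X → ℝ, (∃ C : ℝ, ∀ x, |f x| ≤ C) → IsHarmonic μ f → ∀ x y : X, f x = f y

variable (G) in
/-- The action of `G` on `X` is Liouville: it is `μ`-Liouville for some non-degenerate symmetric
probability measure `μ` on `G`. -/
def IsLiouville (X : Type*) [MulAction G X] : Prop :=
  ∃ μ : PMF G, NonDegenerate μ ∧ Symmetric μ ∧ IsLiouvilleFor X μ

variable (G) in
open scoped Classical in
/-- The action of `G` on `X` is `n`-Liouville: the induced action `g • S = {g x : x ∈ S}` of `G` on
the set of all subsets of `X` of cardinality `n` is Liouville. -/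
def IsNLiouville (n : ℕ) (X : Type*) [MulAction G X] : Prop :=
  IsLiouville G (Set.powersetCard X n)

end Liouville

/-! ### The groups `F_ℝ` and `F` -/

/-- The dyadic rationals, as a set of real numbers. -/
def dyadicRationals : Set ℝ :=
  {x | ∃ (a : ℤ) (n : ℕ), x = a / 2 ^ n}

/-- `f` is piecewise linear with finitely many breakpoints, all of them dyadic rationals, and with
slopes powers of two: off a finite set `S` of dyadic rationals, `f` is locally of the form
`y ↦ 2 ^ k * y + b` (hence of this form on each component of the complement of `S`). -/
def IsDyadicPL (f : ℝ → ℝ) : Prop :=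
  ∃ S : Set ℝ, S.Finite ∧ S ⊆ dyadicRationals ∧
    ∀ x ∉ S, ∃ (k : ℤ) (b : ℝ), ∀ᶠ y in 𝓝 x, f y = 2 ^ k * y + b

/-- The group `F_ℝ` of piecewise linear homeomorphisms of `ℝ` with slopes powers of two and finitely
many breakpoints, all dyadic, which map the dyadic rationals onto themselves. (The last condition
says that the constant terms are dyadic; it excludes, for example, translations by non-dyadic
numbers, which have no breakpoints.) -/
def thompsonFReal : Subgroup (ℝ ≃ₜ ℝ) where
  carrier := {f | IsDyadicPL f ∧ ∀ x, f x ∈ dyadicRationals ↔ x ∈ dyadicRationals}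
  one_mem' := by
    refine ⟨⟨∅, Set.finite_empty, Set.empty_subset _, fun x _ => ⟨0, 0, ?_⟩⟩, fun x => Iff.rfl⟩
    exact Filter.Eventually.of_forall fun y => by simp
  mul_mem' := by
    rintro f g ⟨⟨S, hS, hSd, hf⟩, hfd⟩ ⟨⟨T, hT, hTd, hg⟩, hgd⟩
    refine ⟨⟨T ∪ g ⁻¹' S, hT.union (hS.preimage g.injective.injOn), ?_, ?_⟩, fun x => ?_⟩
    · rintro x (hx | hx)
      · exact hTd hx
      · exact (hgd x).1 (hSd hx)
    · intro x hx
      rw [Set.mem_union, not_or] at hx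
      obtain ⟨k, b, hk⟩ := hg x hx.1
      obtain ⟨l, c, hl⟩ := hf (g x) hx.2
      refine ⟨l + k, 2 ^ l * b + c, ?_⟩
      filter_upwards [hk, g.continuous.continuousAt.eventually hl] with y h1 h2
      rw [Homeomorph.mul_apply, h2, h1, zpow_add₀ two_ne_zero]
      ring
    · exact (hfd (g x)).trans (hgd x)
  inv_mem' := by
    rintro f ⟨⟨S, hS, hSd, hf⟩, hfd⟩
    refine ⟨⟨f '' S, hS.image f, ?_, ?_⟩, fun x => ?_⟩
    · rintro _ ⟨x, hx, rfl⟩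
      exact (hfd x).2 (hSd hx)
    · intro x hx
      have hx' : f.symm x ∉ S := fun h => hx ⟨_, h, f.apply_symm_apply x⟩
      obtain ⟨k, b, hk⟩ := hf _ hx'
      refine ⟨-k, -(2 ^ (-k) * b), ?_⟩
      filter_upwards [f.symm.continuous.continuousAt.eventually hk] with y h
      change f.symm y = _
      rw [f.apply_symm_apply] at h
      have h2 : (2 : ℝ) ^ (-k) * 2 ^ k = 1 := by
        rw [← zpow_add₀ two_ne_zero, neg_add_cancel, zpow_zero]
      linear_combination (-(2 : ℝ) ^ (-k)) * h - f.symm y * h2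
    · change f.symm x ∈ _ ↔ _
      rw [← hfd (f.symm x), f.apply_symm_apply]

/-- Thompson's group `F`: the elements of `F_ℝ` that are the identity outside of `[0, 1]`. -/
def thompsonF : Subgroup (ℝ ≃ₜ ℝ) where
  carrier := {f | f ∈ thompsonFReal ∧ ∀ x ∉ Set.Icc (0 : ℝ) 1, f x = x}
  one_mem' := ⟨thompsonFReal.one_mem, fun _ _ => rfl⟩
  mul_mem' := by
    rintro f g ⟨hf, hf'⟩ ⟨hg, hg'⟩
    refine ⟨thompsonFReal.mul_mem hf hg, fun x hx => ?_⟩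
    rw [Homeomorph.mul_apply, hg' x hx, hf' x hx]
  inv_mem' := by
    rintro f ⟨hf, hf'⟩
    refine ⟨thompsonFReal.inv_mem hf, fun x hx => ?_⟩
    change f.symm x = x
    rw [f.symm_apply_eq, hf' x hx]

/-- The action of `F_ℝ` on the dyadic rationals, by evaluation. -/
instance : MulAction thompsonFReal dyadicRationals where
  smul f x := ⟨f.1 x.1, (f.2.2 x.1).2 x.2⟩
  one_smul _ := rfl
  mul_smul _ _ _ := rfl

/-- The dyadic rationals in the open interval `(0, 1)`. -/
def unitDyadicRationals : Set ℝ :=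
  dyadicRationals ∩ Set.Ioo 0 1

/-- An element of `F` maps `(0, 1)` to itself. -/
theorem thompsonF_apply_mem_Ioo {f : ℝ ≃ₜ ℝ} (hf : f ∈ thompsonF) {x : ℝ}
    (hx : x ∈ Set.Ioo (0 : ℝ) 1) : f x ∈ Set.Ioo (0 : ℝ) 1 := by
  have key : ∀ y ∉ Set.Ioo (0 : ℝ) 1, f y = y := by
    have hcl : IsClosed {y | f y = y} := isClosed_eq f.continuous continuous_id
    intro y hy
    rw [Set.mem_Ioo, not_and_or, not_lt, not_lt] at hy
    rcases hy with hy | hy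
    · have h : Set.Iio (0 : ℝ) ⊆ {y | f y = y} :=
        fun z hz => hf.2 z fun h => absurd h.1 (not_le.2 hz)
      have h2 := closure_minimal h hcl
      rw [closure_Iio] at h2
      exact h2 hy
    · have h : Set.Ioi (1 : ℝ) ⊆ {y | f y = y} :=
        fun z hz => hf.2 z fun h => absurd h.2 (not_le.2 hz)
      have h2 := closure_minimal h hcl
      rw [closure_Ioi] at h2
      exact h2 hy
  by_contra h
  have h1 := f.injective (key _ h)
  exact h (h1.symm ▸ hx)

/-- The action of `F` on the dyadic rationals in `(0, 1)`, by evaluation. -/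
instance : MulAction thompsonF unitDyadicRationals where
  smul f x := ⟨f.1 x.1, (f.2.1.2 x.1).2 x.2.1, thompsonF_apply_mem_Ioo f.2 x.2.2⟩
  one_smul _ := rfl
  mul_smul _ _ _ := rfl

end

end ThompsonLiouville

/-!
Let a countable group `G` act on a countable set `Y`. If for every finite `E ⊆ Y` and `ε > 0` some
finitely supported probability measure `p` on `G` makes the measures `p • y`, `y ∈ E`, differ by at
most `ε` in `ℓ¹(Y)` (`HasAlmostInvariant`), then the action is Liouville. This is the argument of
Kaimanovich and Vershik for amenable groups (`isLiouville_of_hasAlmostInvariant`,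
`IsHarmonic.abs_sub_le`): one takes `μ = ∑ w k • σ k`, with `σ k` almost invariant on all points that
the random walk is likely to visit before it first uses some `σ j` with `k ≤ j`. Symmetry of `μ` is
obtained by replacing `p` with the law of `h⁻¹ h'`, for independent `h` and `h'` with law `p`
(`symmetrization`); the first factor to act, `h'`, already makes the positions almost equal in law.

Almost invariant measures on pairs come from the amenability of the affine group. Both actions are
transitive on finite increasing sequences, so points `x₀ < ⋯ < xₘ` can be moved to
`ι a, ι (a + s), …, ι (a + m s)` for any fixed increasing sequence `ι` and any `a`, `s` with `0 < s`.
Choose `s` at random with a law almost invariant under multiplication by `1, …, m`, then `a` with a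
law almost invariant under the relevant translations, both from the amenability of commutative
monoids (`exists_mean_mul_near`). The pair `(xᵢ, xⱼ)` goes to the positions
`(a + i s, a + i s + (j - i) s)`, and their law is close to that of `(a, a + s)` whatever `i < j` are
(`StronglyOrderTransitive.hasAlmostInvariant`).

Transitivity is proved by gluing affine elements of `F_ℝ` at dyadic points. The support of a
non-degenerate measure on a group generates it, so `F_ℝ` has to be shown to be countable as well
(`countable_thompsonFReal`).
-/

namespace ThompsonLiouville

/-! ### Means of bounded functions -/

section Mean

variable {α β : Type*}

/-- The expectation `∑ p(a) φ(a)` of a real function. It is used for bounded `φ` only, for which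
the sum converges. -/
noncomputable def mean (p : PMF α) (φ : α → ℝ) : ℝ :=
  ∑' a, (p a).toReal * φ a

theorem summable_pmf_toReal (p : PMF α) : Summable fun a => (p a).toReal :=
  ENNReal.summable_toReal p.tsum_coe_ne_top

theorem tsum_pmf_toReal (p : PMF α) : ∑' a, (p a).toReal = 1 := by
  rw [← ENNReal.tsum_toReal_eq fun a => p.apply_ne_top a, p.tsum_coe, ENNReal.toReal_one]

theorem summable_mean (p : PMF α) {φ : α → ℝ} {C : ℝ} (h : ∀ a, |φ a| ≤ C) :
    Summable fun a => (p a).toReal * φ a := by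
  refine Summable.of_norm_bounded ((summable_pmf_toReal p).mul_right C) fun a => ?_
  rw [Real.norm_eq_abs, abs_mul, abs_of_nonneg ENNReal.toReal_nonneg]
  exact mul_le_mul_of_nonneg_left (h a) ENNReal.toReal_nonneg

theorem mean_const (p : PMF α) (c : ℝ) : mean p (fun _ => c) = c := by
  rw [mean, tsum_mul_right, tsum_pmf_toReal, one_mul]

theorem mean_const_mul (p : PMF α) (c : ℝ) (φ : α → ℝ) :
    mean p (fun a => c * φ a) = c * mean p φ := by
  simp only [mean, ← tsum_mul_left]
  exact tsum_congr fun a => by ring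

theorem mean_add (p : PMF α) {φ ψ : α → ℝ} {C D : ℝ} (hφ : ∀ a, |φ a| ≤ C)
    (hψ : ∀ a, |ψ a| ≤ D) : mean p (fun a => φ a + ψ a) = mean p φ + mean p ψ := by
  rw [mean, mean, mean, ← (summable_mean p hφ).tsum_add (summable_mean p hψ)]
  exact tsum_congr fun a => by ring

theorem mean_sub (p : PMF α) {φ ψ : α → ℝ} {C D : ℝ} (hφ : ∀ a, |φ a| ≤ C)
    (hψ : ∀ a, |ψ a| ≤ D) : mean p (fun a => φ a - ψ a) = mean p φ - mean p ψ := by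
  rw [mean, mean, mean, ← (summable_mean p hφ).tsum_sub (summable_mean p hψ)]
  exact tsum_congr fun a => by ring

theorem mean_mono (p : PMF α) {φ ψ : α → ℝ} {C D : ℝ} (hφ : ∀ a, |φ a| ≤ C)
    (hψ : ∀ a, |ψ a| ≤ D) (h : ∀ a ∈ p.support, φ a ≤ ψ a) : mean p φ ≤ mean p ψ := by
  refine (summable_mean p hφ).tsum_le_tsum (fun a => ?_) (summable_mean p hψ)
  by_cases ha : a ∈ p.support
  · exact mul_le_mul_of_nonneg_left (h a ha) ENNReal.toReal_nonneg
  · simp [(p.apply_eq_zero_iff a).2 ha]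

theorem abs_mean_le_mean (p : PMF α) {φ ψ : α → ℝ} {C D : ℝ} (hφ : ∀ a, |φ a| ≤ C)
    (hψ : ∀ a, |ψ a| ≤ D) (h : ∀ a ∈ p.support, |φ a| ≤ ψ a) : |mean p φ| ≤ mean p ψ := by
  rw [abs_le, neg_le, ← neg_one_mul, ← mean_const_mul]
  refine ⟨mean_mono p (C := C) (fun a => ?_) hψ fun a ha => ?_,
    mean_mono p hφ hψ fun a ha => (le_abs_self _).trans (h a ha)⟩
  · simpa using hφ a
  · simpa using (neg_le_abs _).trans (h a ha)

theorem abs_mean_le (p : PMF α) {φ : α → ℝ} {C D : ℝ} (hφ : ∀ a, |φ a| ≤ C)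
    (h : ∀ a ∈ p.support, |φ a| ≤ D) : |mean p φ| ≤ D :=
  (abs_mean_le_mean p hφ (fun _ => le_rfl) h).trans_eq (mean_const p D)

theorem mean_pure (a : α) (φ : α → ℝ) : mean (PMF.pure a) φ = φ a := by
  rw [mean, tsum_eq_single a fun b hb => by simp [PMF.pure_apply, hb]]
  simp

theorem mean_bind (p : PMF α) (q : α → PMF β) {φ : β → ℝ} {C : ℝ} (hφ : ∀ b, |φ b| ≤ C) :
    mean (p.bind q) φ = mean p fun a => mean (q a) φ := by
  have hs : Summable fun x : α × β => (p x.1).toReal * ((q x.1 x.2).toReal * φ x.2) := by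
    have h1 : Summable fun x : α × β => (p x.1).toReal * (q x.1 x.2).toReal := by
      refine (summable_prod_of_nonneg ?_).2 ⟨fun a => ?_, ?_⟩
      · exact fun x => mul_nonneg ENNReal.toReal_nonneg ENNReal.toReal_nonneg
      · exact (summable_pmf_toReal (q a)).mul_left (p a).toReal
      · simp only [tsum_mul_left, tsum_pmf_toReal, mul_one]
        exact summable_pmf_toReal p
    refine Summable.of_norm_bounded (h1.mul_right C) fun x => ?_
    rw [← mul_assoc, Real.norm_eq_abs, abs_mul, abs_of_nonneg
      (mul_nonneg ENNReal.toReal_nonneg ENNReal.toReal_nonneg)]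
    exact mul_le_mul_of_nonneg_left (hφ _)
      (mul_nonneg ENNReal.toReal_nonneg ENNReal.toReal_nonneg)
  have hb : ∀ b, (p.bind q b).toReal = ∑' a, (p a).toReal * (q a b).toReal := fun b => by
    rw [PMF.bind_apply, ENNReal.tsum_toReal_eq fun a =>
      ENNReal.mul_ne_top (p.apply_ne_top a) ((q a).apply_ne_top b)]
    simp only [ENNReal.toReal_mul]
  calc mean (p.bind q) φ = ∑' b, ∑' a, (p a).toReal * ((q a b).toReal * φ b) := by
        refine tsum_congr fun b => ?_
        rw [hb, ← tsum_mul_right]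
        exact tsum_congr fun a => by ring
    _ = ∑' a, ∑' b, (p a).toReal * ((q a b).toReal * φ b) := hs.tsum_comm
    _ = mean p fun a => mean (q a) φ := tsum_congr fun a => tsum_mul_left

theorem mean_map (p : PMF α) (h : α → β) {φ : β → ℝ} {C : ℝ} (hφ : ∀ b, |φ b| ≤ C) :
    mean (p.map h) φ = mean p fun a => φ (h a) := by
  simp only [PMF.map, mean_bind p _ hφ, Function.comp_apply, mean_pure]

theorem mean_uniformOfFintype [Fintype α] [Nonempty α] (φ : α → ℝ) :
    mean (PMF.uniformOfFintype α) φ = (Fintype.card α : ℝ)⁻¹ * ∑ a, φ a := by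
  simp [mean, tsum_fintype, Finset.mul_sum]

end Mean

/-! ### Harmonic functions and almost invariant measures -/

section Criterion

variable {G Y : Type*} [Group G] [MulAction G Y]

/-- A bounded harmonic function is invariant under averaging over one step of the random walk. -/
theorem IsHarmonic.mean_eq {μ : PMF G} {f : Y → ℝ} (hf : IsHarmonic μ f) {C : ℝ}
    (hC : ∀ y, |f y| ≤ C) (x : Y) : mean μ (fun g => f (g • x)) = f x := by
  rw [← (hf x).tsum_eq, mean]
  have hs := summable_mean μ fun g => hC (g • x)
  let e := Equiv.sigmaFiberEquiv fun g : G => g • x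
  refine (e.tsum_eq _).symm.trans (((e.summable_iff).2 hs).tsum_sigma.trans ?_)
  refine tsum_congr fun y => ?_
  rw [transitionProb, ← tsum_mul_left]
  refine tsum_congr fun g => ?_
  change (μ g.1).toReal * f (g.1 • x) = _
  rw [g.2, mul_comm]

/-- The measures `p • y`, for `y ∈ E`, on `Y` are within `ε` of each other in the norm of `ℓ¹(Y)`,
expressed by pairing with bounded functions. -/
def AlmostInvariant (p : PMF G) (E : Set Y) (ε : ℝ) : Prop :=
  ∀ (f : Y → ℝ) (C : ℝ), (∀ y, |f y| ≤ C) → ∀ y ∈ E, ∀ z ∈ E,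
    |mean p (fun g => f (g • y)) - mean p (fun g => f (g • z))| ≤ ε * C

theorem AlmostInvariant.mono {p : PMF G} {E E' : Set Y} {ε ε' : ℝ}
    (h : AlmostInvariant p E ε) (hE : E' ⊆ E) (hε : ε ≤ ε') : AlmostInvariant p E' ε' :=
  fun f C hC y hy z hz => (h f C hC y (hE hy) z (hE hz)).trans
    (mul_le_mul_of_nonneg_right hε ((abs_nonneg _).trans (hC y)))

variable (G Y) in
/-- Every finite subset of `Y` has, for every `ε > 0`, a finitely supported `ε`-almost invariant
probability measure on `G`. -/
def HasAlmostInvariant : Prop :=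
  ∀ (E : Set Y) (ε : ℝ), E.Finite → 0 < ε → ∃ p : PMF G, p.support.Finite ∧ AlmostInvariant p E ε

theorem symmetric_of_map_inv {p : PMF G} (h : p.map (·⁻¹) = p) : Symmetric p := by
  intro g
  conv_rhs => rw [← h, PMF.map_apply]
  rw [tsum_eq_single g⁻¹ fun b hb => if_neg fun h => hb (by rw [h, inv_inv])]
  simp

theorem map_inv_of_symmetric {p : PMF G} (h : Symmetric p) : p.map (·⁻¹) = p := by
  ext g
  rw [PMF.map_apply, tsum_eq_single g⁻¹ fun b hb => if_neg fun h => hb (by rw [h, inv_inv]), ← h g]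
  simp

theorem Symmetric.bind {α : Type*} (p : PMF α) {q : α → PMF G} (h : ∀ a, Symmetric (q a)) :
    Symmetric (p.bind q) := by
  apply symmetric_of_map_inv
  rw [PMF.map_bind]
  simp only [map_inv_of_symmetric (h _)]

/-- The law of `h⁻¹ h'` for independent `h` and `h'` with law `p`. It is symmetric, and it
inherits almost invariance from `p`, since `h'` is the first of the two factors to act. -/
noncomputable def symmetrization (p : PMF G) : PMF G :=
  p.bind fun h => p.map fun h' => h⁻¹ * h'

theorem symmetric_symmetrization (p : PMF G) : Symmetric (symmetrization p) := by
  apply symmetric_of_map_inv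
  simp only [symmetrization, PMF.map, PMF.bind_bind, PMF.pure_bind, Function.comp_def,
    mul_inv_rev, inv_inv]
  exact PMF.bind_comm p p fun h h' => PMF.pure (h'⁻¹ * h)

theorem finite_support_bind {α β : Type*} {p : PMF α} {q : α → PMF β} (hp : p.support.Finite)
    (hq : ∀ a, (q a).support.Finite) : (p.bind q).support.Finite := by
  rw [PMF.support_bind]
  exact hp.biUnion fun a _ => hq a

theorem finite_support_map {α β : Type*} {p : PMF α} (f : α → β) (hp : p.support.Finite) :
    (p.map f).support.Finite := by
  rw [PMF.support_map]
  exact hp.image f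

theorem AlmostInvariant.symmetrization {p : PMF G} {E : Set Y} {ε : ℝ}
    (h : AlmostInvariant p E ε) : AlmostInvariant (symmetrization p) E ε := by
  intro f C hC y hy z hz
  have key : ∀ y, mean (ThompsonLiouville.symmetrization p) (fun g => f (g • y)) =
      mean p fun a => mean p fun b => f (a⁻¹ • b • y) := fun y => by
    rw [ThompsonLiouville.symmetrization, mean_bind _ _ fun g => hC (g • y)]
    refine congrArg _ (funext fun a => ?_)
    rw [mean_map _ _ fun g => hC (g • y)]
    simp only [mul_smul]
  have hm : ∀ (y : Y) (a : G), |mean p fun b => f (a⁻¹ • b • y)| ≤ C := fun y a =>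
    abs_mean_le p (fun b => hC _) fun b _ => hC _
  rw [key, key, ← mean_sub p (hm y) (hm z)]
  have h2 : ∀ a : G, |(mean p fun b => f (a⁻¹ • b • y)) - mean p fun b => f (a⁻¹ • b • z)| ≤ ε * C :=
    fun a => h (fun x => f (a⁻¹ • x)) C (fun _ => hC _) y hy z hz
  exact abs_mean_le p h2 fun a _ => h2 a

/-- The measure is obtained by symmetrizing and adding a small multiple of the uniform measure on
`{g, g⁻¹}`. -/
theorem HasAlmostInvariant.exists_symmetric (H : HasAlmostInvariant G Y) (g : G) {E : Set Y}
    {ε : ℝ} (hE : E.Finite) (hε : 0 < ε) :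
    ∃ p : PMF G, p.support.Finite ∧ Symmetric p ∧ g ∈ p.support ∧ AlmostInvariant p E ε := by
  obtain ⟨p, hp, hpE⟩ := H E (ε / 2) hE (by positivity)
  obtain ⟨n, hn⟩ := exists_nat_one_div_lt (show 0 < ε / 4 by positivity)
  let u : PMF G := (PMF.uniformOfFintype Bool).map fun b => cond b g g⁻¹
  let s : PMF G := symmetrization p
  let q : Option (Fin n) → PMF G := fun i => i.elim u fun _ => s
  have hu : Symmetric u := by
    apply symmetric_of_map_inv
    have h : ((fun x : G => x⁻¹) ∘ fun b => cond b g g⁻¹) = fun b => cond b g⁻¹ g := by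
      funext b
      cases b <;> simp
    simp only [u, PMF.map_comp, h]
    ext x
    rw [PMF.map_apply, PMF.map_apply, tsum_bool, tsum_bool]
    simp [add_comm]
  have hs : AlmostInvariant s E (ε / 2) := hpE.symmetrization
  refine ⟨(PMF.uniformOfFintype (Option (Fin n))).bind q, ?_, ?_, ?_, ?_⟩
  · refine finite_support_bind (Set.toFinite _) fun b => ?_
    rcases b with _ | b
    · exact finite_support_map _ (Set.toFinite _)
    · exact finite_support_bind hp fun a => finite_support_map _ hp
  · refine Symmetric.bind _ fun b => ?_
    rcases b with _ | b
    · exact hu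
    · exact symmetric_symmetrization p
  · rw [PMF.mem_support_bind_iff]
    refine ⟨none, by simp, ?_⟩
    simp only [q, u, Option.elim_none, PMF.mem_support_map_iff]
    exact ⟨true, by simp, rfl⟩
  · intro f C hC y hy z hz
    have hC0 : 0 ≤ C := (abs_nonneg _).trans (hC y)
    have key : ∀ y, mean ((PMF.uniformOfFintype (Option (Fin n))).bind q) (fun g => f (g • y)) =
        (n + 1 : ℝ)⁻¹ * (mean u (fun g => f (g • y)) + n * mean s (fun g => f (g • y))) :=
      fun y => by
        rw [mean_bind _ _ fun g => hC (g • y), mean_uniformOfFintype]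
        simp [q]
    rw [key, key]
    have h1 := hs f C hC y hy z hz
    have h2 : ∀ y, |mean u (fun g => f (g • y))| ≤ C := fun y =>
      abs_mean_le u (fun g => hC _) fun g _ => hC _
    have h3 := abs_le.1 (h2 y)
    have h4 := abs_le.1 (h2 z)
    have hn0 : (0 : ℝ) < n + 1 := by positivity
    calc _ = (n + 1 : ℝ)⁻¹ * |(mean u (fun g => f (g • y)) - mean u (fun g => f (g • z))) +
          n * (mean s (fun g => f (g • y)) - mean s (fun g => f (g • z)))| := by
            rw [← abs_of_pos (inv_pos.2 hn0), ← abs_mul, abs_of_pos (inv_pos.2 hn0)]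
            congr 1; ring
      _ ≤ (n + 1 : ℝ)⁻¹ * (2 * C + n * (ε / 2 * C)) := by
        refine mul_le_mul_of_nonneg_left ((abs_add_le _ _).trans (add_le_add ?_ ?_))
          (inv_pos.2 hn0).le
        · exact abs_le.2 ⟨by linarith, by linarith⟩
        · rw [abs_mul, Nat.abs_cast]
          exact mul_le_mul_of_nonneg_left h1 (Nat.cast_nonneg n)
      _ = 1 / (n + 1 : ℝ) * (2 * C) + (1 - 1 / (n + 1 : ℝ)) * (ε / 2 * C) := by
        field_simp; ring
      _ ≤ ε / 4 * (2 * C) + 1 * (ε / 2 * C) := by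
        gcongr
        exact sub_le_self _ (by positivity)
      _ = ε * C := by ring

end Criterion

/-! ### Liouville measures from almost invariant measures -/

section Liouville

open scoped Pointwise

variable {G Y : Type*} [Group G] [MulAction G Y]

theorem mean_lt_one {w : PMF ℕ} (hw : ∀ k, k ∈ w.support) (k : ℕ) :
    mean w (fun j => if j < k then 1 else 0) < 1 := by
  have h1 : ∀ j, |if j < k then (1 : ℝ) else 0| ≤ 1 := fun j => by split_ifs <;> simp
  have h2 := (summable_mean w fun j => (by simp : |(1 : ℝ)| ≤ 1))
  have h3 := (summable_mean w h1).tsum_lt_tsum (i := k) (fun j => ?_) ?_ h2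
  · exact h3.trans_eq (mean_const w 1)
  · refine mul_le_mul_of_nonneg_left ?_ ENNReal.toReal_nonneg
    split_ifs <;> simp
  · simpa using ENNReal.toReal_pos ((w.mem_support_iff k).1 (hw k)) (w.apply_ne_top k)

/-- The coupling estimate for the random walk that chooses `j` with law `w` and then moves by an
element with law `σ j`. Among `n` steps, with probability at least `1 - s ^ n` there is one
with `k ≤ j`; up to the first such step the walk stays in the sets `B m`, and that step
almost erases the dependence on the starting point. -/
theorem IsHarmonic.abs_sub_le {w : PMF ℕ} {σ : ℕ → PMF G} {f : Y → ℝ}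
    (hf : IsHarmonic (w.bind σ) f) {C : ℝ} (hC : ∀ y, |f y| ≤ C) {k N : ℕ} {ε : ℝ} (hε : 0 ≤ ε)
    {B : ℕ → Set Y}
    (hB : ∀ n, ∀ j < k, ∀ g ∈ (σ j).support, ∀ y ∈ B n, g • y ∈ B (n + 1))
    (hσ : ∀ j, k ≤ j → ∀ n ≤ N, AlmostInvariant (σ j) (B n) ε) (n m : ℕ) (hnm : m + n ≤ N)
    {y z : Y} (hy : y ∈ B m) (hz : z ∈ B m) :
    |f y - f z| ≤ ε * C + 2 * C * mean w (fun j => if j < k then 1 else 0) ^ n := by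
  have hC0 : 0 ≤ C := (abs_nonneg _).trans (hC y)
  have hd : ∀ y z, |f y - f z| ≤ 2 * C := fun y z => by
    have h1 := abs_le.1 (hC y)
    have h2 := abs_le.1 (hC z)
    exact abs_le.2 ⟨by linarith, by linarith⟩
  induction n generalizing m y z with
  | zero =>
    rw [pow_zero, mul_one]
    exact (hd y z).trans (le_add_of_nonneg_left (mul_nonneg hε hC0))
  | succ n ih =>
    set s := mean w (fun j => if j < k then 1 else 0) with hs
    set D := 2 * C * s ^ n with hD
    have hs0 : 0 ≤ s := tsum_nonneg fun j => mul_nonneg ENNReal.toReal_nonneg (by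
      dsimp only
      split_ifs <;> simp)
    have hD0 : 0 ≤ D := by positivity
    have hm : ∀ (j : ℕ) (y : Y), |mean (σ j) fun g => f (g • y)| ≤ C := fun j y =>
      abs_mean_le _ (fun g => hC _) fun g _ => hC _
    have hfe : ∀ y, f y = mean w fun j => mean (σ j) fun g => f (g • y) := fun y => by
      rw [← mean_bind _ _ fun g => hC (g • y), hf.mean_eq hC]
    have hdiff : ∀ j, (mean (σ j) fun g => f (g • y)) - (mean (σ j) fun g => f (g • z)) =
        mean (σ j) fun g => f (g • y) - f (g • z) := fun j =>
      (mean_sub _ (fun g => hC _) fun g => hC _).symm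
    rw [hfe y, hfe z, ← mean_sub w (fun j => hm j y) fun j => hm j z]
    have hi : ∀ j, |if j < k then (1 : ℝ) else 0| ≤ 1 := fun j => by split_ifs <;> simp
    have hi' : ∀ j, |D * if j < k then (1 : ℝ) else 0| ≤ D := fun j => by
      rw [abs_mul, abs_of_nonneg hD0]
      exact mul_le_of_le_one_right hD0 (hi j)
    refine (abs_mean_le_mean w (ψ := fun j => ε * C + D * if j < k then 1 else 0)
      (C := 2 * C) (D := ε * C + D) (fun j => ?_) (fun j => ?_) fun j _ => ?_).trans ?_
    · rw [hdiff]
      exact abs_mean_le _ (fun g => hd _ _) fun g _ => hd _ _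
    · refine (abs_add_le _ _).trans (add_le_add (abs_of_nonneg (mul_nonneg hε hC0)).le (hi' j))
    · split_ifs with hj
      · rw [hdiff, mul_one]
        exact abs_mean_le _ (fun g => hd _ _) fun g hg =>
          ih (m + 1) (by omega) (hB m j hj g hg y hy) (hB m j hj g hg z hz)
      · rw [mul_zero, add_zero]
        exact hσ j (not_lt.1 hj) m (by omega) f C hC y hy z hz
    · rw [mean_add w (fun _ => le_rfl) hi', mean_const, mean_const_mul, ← hs, hD, pow_succ]
      exact le_of_eq (by ring)

theorem finite_iterate_smul {S : Set G} {E : Set Y} (hS : S.Finite) (hE : E.Finite) (n : ℕ) :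
    ((fun B => S • B)^[n] E).Finite := by
  induction n with
  | zero => exact hE
  | succ n ih =>
    rw [Function.iterate_succ_apply']
    exact hS.smul ih

variable (G) in
/-- A countable set on which a countable group acts with finitely supported almost invariant
measures has a Liouville action. The measure `μ` is a convex combination, with all weights positive,
of measures `σ k` chosen one after the other: `σ k` is almost invariant on all points reached from
the first `k` points within `N k` steps taken from the supports of the earlier measures, where `N k`
is so large that a random walk of that length hardly avoids the measures `σ j` with `k ≤ j`. -/
theorem isLiouville_of_hasAlmostInvariant [Countable G] [Countable Y] [Nonempty Y]
    (H : HasAlmostInvariant G Y) : IsLiouville G Y := by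
  obtain ⟨γ, hγ⟩ := exists_surjective_nat G
  obtain ⟨e, he⟩ := exists_surjective_nat Y
  have hw1 : ∑' k : ℕ, (2⁻¹ : ENNReal) ^ k = 2 := by
    rw [ENNReal.tsum_geometric, ENNReal.one_sub_inv_two, inv_inv]
  let w : PMF ℕ := PMF.normalize (fun k => (2⁻¹ : ENNReal) ^ k) (by simp [hw1]) (by simp [hw1])
  have hw : ∀ k, k ∈ w.support := fun k => by
    rw [PMF.mem_support_normalize_iff]
    simp
  have hN : ∀ k : ℕ, ∃ N : ℕ,
      mean w (fun j => if j < k then 1 else 0) ^ N < 1 / ((k : ℝ) + 1) := fun k =>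
    exists_pow_lt_of_lt_one (by positivity) (mean_lt_one hw k)
  choose N hN using hN
  choose τ hτ using fun (k : ℕ) (E : {E : Set Y // E.Finite}) =>
    H.exists_symmetric (γ k) E.2 (show 0 < 1 / ((k : ℝ) + 1) by positivity)
  -- The points on which the `k`-th measure has to be almost invariant, where `S` contains the supports
  -- of the earlier measures and `E` is the set used for the one before.
  let grow : ℕ → {S : Set G // S.Finite} → {E : Set Y // E.Finite} → {E : Set Y // E.Finite} :=
    fun k S E => ⟨E.1 ∪ ⋃ n ∈ Set.Iic (N k), (fun B => S.1 • B)^[n] (e '' Set.Iic k),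
      E.2.union ((Set.finite_Iic _).biUnion fun n _ =>
        finite_iterate_smul S.2 ((Set.finite_Iic k).image e) n)⟩
  -- `st k` consists of the union of the supports chosen so far and of the set of points on which
  -- the last measure is almost invariant.
  let st : ℕ → {S : Set G // S.Finite} × {E : Set Y // E.Finite} := fun k =>
    Nat.rec (⟨∅, Set.finite_empty⟩, ⟨∅, Set.finite_empty⟩)
      (fun k x => (⟨x.1.1 ∪ (τ k (grow k x.1 x.2)).support, x.1.2.union (hτ k _).1⟩,
        grow k x.1 x.2)) k
  let σ : ℕ → PMF G := fun k => τ k (st (k + 1)).2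
  have hst : ∀ k, (st k).1.1 ⊆ (st (k + 1)).1.1 := fun k => Set.subset_union_left
  have hst' : ∀ k, (σ k).support ⊆ (st (k + 1)).1.1 := fun k => Set.subset_union_right
  have hE : Monotone fun k => (st k).2.1 :=
    monotone_nat_of_le_succ fun k => Set.subset_union_left
  have hS : ∀ k, ∀ j < k, (σ j).support ⊆ (st k).1.1 := fun k j hj =>
    (hst' j).trans (monotone_nat_of_le_succ (f := fun k => (st k).1.1) hst hj)
  have hgrow : ∀ k, ∀ n ≤ N k,
      (fun B => (st k).1.1 • B)^[n] (e '' Set.Iic k) ⊆ (st (k + 1)).2.1 := fun k n hn =>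
    (Set.subset_biUnion_of_mem (u := fun n => (fun B => (st k).1.1 • B)^[n] (e '' Set.Iic k))
      (Set.mem_Iic.2 hn)).trans Set.subset_union_right
  refine ⟨w.bind σ, ?_, Symmetric.bind _ fun k => (hτ k _).2.1, ?_⟩
  · refine (Subsemigroup.eq_top_iff' _).2 fun g => Subsemigroup.subset_closure ?_
    obtain ⟨k, rfl⟩ := hγ g
    exact (PMF.mem_support_bind_iff _ _ _).2 ⟨k, hw k, (hτ k _).2.2.1⟩
  · rintro f ⟨C, hC⟩ hf x y
    obtain ⟨a, rfl⟩ := he x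
    obtain ⟨b, rfl⟩ := he y
    have hC0 : 0 ≤ C := (abs_nonneg _).trans (hC (e a))
    have key : ∀ k : ℕ, a ⊔ b ≤ k → |f (e a) - f (e b)| ≤ 3 * C * (1 / ((k : ℝ) + 1)) := by
      intro k hk
      have h := hf.abs_sub_le hC (k := k) (N := N k) (ε := 1 / ((k : ℝ) + 1)) (by positivity)
        (B := fun n => (fun B => (st k).1.1 • B)^[n] (e '' Set.Iic k)) ?_ ?_ (N k) 0
        (by omega) (y := e a) (z := e b) ⟨a, le_sup_left.trans hk, rfl⟩
        ⟨b, le_sup_right.trans hk, rfl⟩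
      · refine h.trans ?_
        have := mul_le_mul_of_nonneg_left (hN k).le (show 0 ≤ 2 * C by positivity)
        linarith
      · intro n j hj g hg y hy
        simp only [Function.iterate_succ_apply']
        exact Set.smul_mem_smul (hS k j hj hg) hy
      · intro j hj n hn
        refine (hτ j _).2.2.2.mono ((hgrow k n hn).trans (hE (Nat.succ_le_succ hj))) ?_
        exact one_div_le_one_div_of_le (by positivity) (by gcongr)
    have hlim : Filter.Tendsto (fun k : ℕ => 3 * C * (1 / ((k : ℝ) + 1))) Filter.atTop (𝓝 0) := by
      simpa using tendsto_one_div_add_atTop_nhds_zero_nat.const_mul (3 * C)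
    have h0 := ge_of_tendsto hlim (Filter.eventually_atTop.2 ⟨a ⊔ b, key⟩)
    exact sub_eq_zero.1 (abs_nonpos_iff.1 h0)

end Liouville

/-! ### Almost invariant measures on pairs -/

section Pairs

open scoped Pointwise

/-- Commutative monoids are amenable: the measure for `insert d D` spreads the one for `D` along
`1, d, …, d ^ n` with large `n`. -/
@[to_additive /-- Commutative additive monoids are amenable. -/]
theorem exists_mean_mul_near {M : Type*} [CommMonoid M] {D : Set M} (hD : D.Finite) {δ : ℝ}
    (hδ : 0 < δ) : ∃ p : PMF M, p.support.Finite ∧ ∀ (F : M → ℝ) (C : ℝ), (∀ x, |F x| ≤ C) →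
      ∀ d ∈ D, |mean p (fun s => F (d * s)) - mean p F| ≤ δ * C := by
  induction D, hD using Set.Finite.induction_on with
  | empty => exact ⟨PMF.pure 1, by simp, fun _ _ _ d hd => hd.elim⟩
  | @insert a D _ _ ih =>
    obtain ⟨p, hp, hpD⟩ := ih
    obtain ⟨n, hn⟩ := exists_nat_one_div_lt (show 0 < δ / 2 by positivity)
    refine ⟨(PMF.uniformOfFintype (Fin (n + 1))).bind fun j => p.map fun s => a ^ (j : ℕ) * s,
      finite_support_bind (Set.toFinite _) fun j => finite_support_map _ hp, fun F C hC d hd => ?_⟩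
    have hC0 : 0 ≤ C := (abs_nonneg _).trans (hC 1)
    have hm : ∀ x : M, |mean p fun s => F (x * s)| ≤ C := fun x =>
      abs_mean_le p (fun s => hC _) fun s _ => hC _
    have key : ∀ F : M → ℝ, (∀ x, |F x| ≤ C) →
        mean ((PMF.uniformOfFintype (Fin (n + 1))).bind fun j => p.map fun s => a ^ (j : ℕ) * s) F =
        mean (PMF.uniformOfFintype (Fin (n + 1))) fun j => mean p fun s => F (a ^ (j : ℕ) * s) :=
      fun F hF => by
        rw [mean_bind _ _ hF]
        exact congrArg _ (funext fun j => mean_map _ _ hF)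
    rw [key F hC, key (fun s => F (d * s)) fun x => hC _]
    rcases hd with rfl | hd
    · have h2 : ∀ j : ℕ, (mean p fun s => F (d * (d ^ j * s))) =
          mean p fun s => F (d ^ (j + 1) * s) := fun j => by simp only [pow_succ', mul_assoc]
      simp only [h2]
      rw [mean_uniformOfFintype, mean_uniformOfFintype, ← mul_sub, ← Finset.sum_sub_distrib,
        Fin.sum_univ_eq_sum_range
          (fun j => (mean p fun s => F (d ^ (j + 1) * s)) - mean p fun s => F (d ^ j * s)),
        Finset.sum_range_sub fun j => mean p fun s => F (d ^ j * s), Fintype.card_fin, abs_mul]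
      have h3 := abs_le.1 (hm (d ^ (n + 1)))
      have h4 := abs_le.1 (hm (d ^ 0))
      have h5 : |((n + 1 : ℕ) : ℝ)⁻¹| ≤ δ / 2 := by
        rw [abs_of_nonneg (by positivity), ← one_div]
        push_cast
        exact hn.le
      calc _ ≤ δ / 2 * (2 * C) := mul_le_mul h5 (abs_le.2 ⟨by linarith, by linarith⟩)
            (abs_nonneg _) (by positivity)
        _ = δ * C := by ring
    · have h2 : ∀ j : ℕ, |(mean p fun s => F (d * (a ^ j * s))) -
          mean p fun s => F (a ^ j * s)| ≤ δ * C := fun j => by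
        simp only [mul_left_comm d]
        exact hpD (fun s => F (a ^ j * s)) C (fun _ => hC _) d hd
      rw [← mean_sub _ (C := C) (D := C) (fun j => ?_) fun j => hm _]
      · exact abs_mean_le _ (fun j => h2 j) fun j _ => h2 j
      · exact abs_mean_le p (fun s => hC _) fun s _ => hC _

variable {G X : Type*} [Group G] [MulAction G X]

variable (G) in
/-- Every strictly increasing map from a finite subset of `X` to `X` is the restriction of the action
of an element of `G`. The order on `X` is the one pulled back along `v : X → ℝ`. -/
def StronglyOrderTransitive (v : X → ℝ) : Prop :=
  ∀ (P : Finset X) (φ : X → X), (∀ x ∈ P, ∀ y ∈ P, v x < v y → v (φ x) < v (φ y)) →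
    ∃ g : G, ∀ x ∈ P, g • x = φ x

/-- Number the points of a finite set by `r`, in increasing order, and move the one with number
`i` to position `a + i s` in an infinite increasing sequence, where `a` and `s` are random. If the
law of `s` is almost invariant under multiplication by small numbers, and the law of `a` is
almost invariant under translation by the `i s`, then `(a + i s, a + j s)` has for all `i < j`
almost the same law as `(a, a + s)`. -/
theorem StronglyOrderTransitive.hasAlmostInvariant [DecidableEq X] {v : X → ℝ}
    (hv : Function.Injective v) (hG : StronglyOrderTransitive G v) {ι : ℕ → X}
    (hι : StrictMono (v ∘ ι)) : HasAlmostInvariant G (Set.powersetCard X 2) := by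
  intro E ε hE hε
  let P : Finset X := hE.toFinset.biUnion fun y => y.1
  let r : X → ℕ := fun x => (P.filter fun p => v p < v x).card
  have hr : ∀ x ∈ P, ∀ y, v x < v y → r x < r y := by
    intro x hx y hxy
    refine Finset.card_lt_card ((Finset.ssubset_iff_of_subset fun p hp => ?_).2 ⟨x, ?_, ?_⟩)
    · rw [Finset.mem_filter] at hp ⊢
      exact ⟨hp.1, hp.2.trans hxy⟩
    · exact Finset.mem_filter.2 ⟨hx, hxy⟩
    · simp
  have hrP : ∀ x, r x ≤ P.card := fun x => Finset.card_filter_le _ _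
  obtain ⟨p₁, hp₁, hp₁D⟩ := exists_mean_mul_near (M := ℕ+)
    (Set.finite_Iic P.card.succPNat) (show 0 < ε / 4 by positivity)
  obtain ⟨p₂, hp₂, hp₂D⟩ := exists_mean_add_near (M := ℕ)
    (D := Set.image2 (fun (i : ℕ) (s : ℕ+) => i * s) (Set.Iic P.card) p₁.support)
    ((Set.finite_Iic _).image2 _ hp₁) (show 0 < ε / 4 by positivity)
  choose g hg using fun (s : ℕ+) (a : ℕ) => hG P (fun x => ι (r x * s + a)) fun x hx y _ hxy =>
    hι (Nat.add_lt_add_right (Nat.mul_lt_mul_of_pos_right (hr x hx y hxy) s.pos) a)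
  refine ⟨p₁.bind fun s => p₂.map (g s),
    finite_support_bind hp₁ fun s => finite_support_map _ hp₂, fun f C hC y hy z hz => ?_⟩
  have hC0 : 0 ≤ C := (abs_nonneg _).trans (hC y)
  let F : ℕ → ℕ → ℝ := fun a d =>
    if h : ({ι a, ι (d + a)} : Finset X).card = 2 then f ⟨{ι a, ι (d + a)}, h⟩ else 0
  have hF : ∀ a d, |F a d| ≤ C := fun a d => by
    simp only [F]
    split_ifs
    · exact hC _
    · simpa using hC0
  have hF₂ : ∀ (b d : ℕ), |mean p₂ fun a => F (b + a) d| ≤ C := fun b d =>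
    abs_mean_le _ (fun a => hF _ _) fun a _ => hF _ _
  have hF₂' : ∀ (d : ℕ), |mean p₂ fun a => F a d| ≤ C := fun d =>
    abs_mean_le _ (fun a => hF _ _) fun a _ => hF _ _
  have key : ∀ y ∈ E, |mean (p₁.bind fun s => p₂.map (g s)) (fun h => f (h • y)) -
      mean p₁ fun s => mean p₂ fun a => F a s| ≤ ε / 2 * C := by
    intro y hy
    obtain ⟨x, x', hxx', hyx⟩ : ∃ x x', v x < v x' ∧ y.1 = {x, x'} := by
      obtain ⟨x, x', hne, hyx⟩ := Finset.card_eq_two.1 y.2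
      rcases lt_or_gt_of_ne (hv.ne hne) with h | h
      · exact ⟨x, x', h, hyx⟩
      · exact ⟨x', x, h, hyx.trans (Finset.pair_comm _ _)⟩
    have hP : ∀ a ∈ y.1, a ∈ P := fun a ha =>
      Finset.mem_biUnion.2 ⟨y, hE.mem_toFinset.2 hy, ha⟩
    have hx : x ∈ P := hP x (by simp [hyx])
    have hx' : x' ∈ P := hP x' (by simp [hyx])
    have hrr := hr x hx x' hxx'
    obtain ⟨d, hd⟩ : ∃ d : ℕ+, r x' = d + r x :=
      ⟨⟨r x' - r x, by omega⟩, by rw [PNat.mk_coe]; omega⟩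
    have hdP : d ≤ P.card.succPNat := by
      rw [← PNat.coe_le_coe, Nat.succPNat_coe]
      have := hrP x'
      omega
    have hfF : ∀ (s : ℕ+) (a : ℕ), f (g s a • y) = F (r x * s + a) (d * s : ℕ+) := by
      intro s a
      have h1 : ((g s a • y : Set.powersetCard X 2) : Finset X) =
          {ι (r x * s + a), ι ((d * s : ℕ+) + (r x * s + a))} := by
        rw [Set.powersetCard.coe_smul]
        rw [hyx, Finset.smul_finset_insert, Finset.smul_finset_singleton, hg s a x hx,
          hg s a x' hx', hd, PNat.mul_coe, add_mul, add_assoc]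
      have h2 := (g s a • y).2
      simp only [F]
      rw [dif_pos (by rw [← h1]; exact h2)]
      exact congrArg f (Subtype.ext h1)
    have h1 : mean (p₁.bind fun s => p₂.map (g s)) (fun h => f (h • y)) =
        mean p₁ fun s => mean p₂ fun a => F (r x * s + a) (d * s : ℕ+) := by
      rw [mean_bind _ _ fun h => hC (h • y)]
      refine congrArg _ (funext fun s => ?_)
      rw [mean_map _ _ fun h => hC (h • y)]
      exact congrArg _ (funext fun a => hfF s a)
    have h2 : |(mean p₁ fun s => mean p₂ fun a => F (r x * s + a) (d * s : ℕ+)) -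
        mean p₁ fun s => mean p₂ fun a => F a (d * s : ℕ+)| ≤ ε / 4 * C := by
      rw [← mean_sub _ (fun s => hF₂ _ _) fun s => hF₂' _]
      refine abs_mean_le p₁ (C := C + C) (fun s => ?_) fun s hs => ?_
      · exact (abs_sub _ _).trans (add_le_add (hF₂ _ _) (hF₂' _))
      · exact hp₂D (fun a => F a (d * s : ℕ+)) C (fun a => hF _ _) _
          ⟨r x, hrP x, s, hs, rfl⟩
    have h3 := hp₁D (fun s => mean p₂ fun a => F a s) C (fun s => hF₂' _) d hdP
    rw [h1]
    calc _ ≤ _ := abs_sub_le _ (mean p₁ fun s => mean p₂ fun a => F a (d * s : ℕ+)) _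
      _ ≤ ε / 4 * C + ε / 4 * C := add_le_add h2 h3
      _ = ε / 2 * C := by ring
  have h1 := abs_le.1 (key y hy)
  have h2 := abs_le.1 (key z hz)
  exact abs_le.2 ⟨by linarith, by linarith⟩

theorem StronglyOrderTransitive.isNLiouville_two [Countable G] [Countable X] {v : X → ℝ}
    (hv : Function.Injective v) (hG : StronglyOrderTransitive G v) {ι : ℕ → X}
    (hι : StrictMono (v ∘ ι)) : IsNLiouville G 2 X := by
  classical
  have : Countable (Set.powersetCard X 2) := inferInstanceAs (Countable {s : Finset X // s.card = 2})
  have : Nonempty (Set.powersetCard X 2) :=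
    ⟨⟨{ι 0, ι 1}, Finset.card_pair (hι.injective.of_comp.ne zero_ne_one)⟩⟩
  exact isLiouville_of_hasAlmostInvariant G (hG.hasAlmostInvariant hv hι)

end Pairs

/-! ### Order transitivity of `F_ℝ` and `F` -/

section Dyadic

theorem intCast_mem_dyadicRationals (a : ℤ) : (a : ℝ) ∈ dyadicRationals :=
  ⟨a, 0, by simp⟩

theorem add_mem_dyadicRationals {x y : ℝ} (hx : x ∈ dyadicRationals) (hy : y ∈ dyadicRationals) :
    x + y ∈ dyadicRationals := by
  obtain ⟨a, n, rfl⟩ := hx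
  obtain ⟨b, m, rfl⟩ := hy
  refine ⟨a * 2 ^ m + b * 2 ^ n, n + m, ?_⟩
  push_cast
  rw [pow_add]
  field_simp

theorem neg_mem_dyadicRationals {x : ℝ} (hx : x ∈ dyadicRationals) : -x ∈ dyadicRationals := by
  obtain ⟨a, n, rfl⟩ := hx
  exact ⟨-a, n, by push_cast; ring⟩

theorem sub_mem_dyadicRationals {x y : ℝ} (hx : x ∈ dyadicRationals) (hy : y ∈ dyadicRationals) :
    x - y ∈ dyadicRationals :=
  sub_eq_add_neg x y ▸ add_mem_dyadicRationals hx (neg_mem_dyadicRationals hy)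

theorem zpow_mul_mem_dyadicRationals (k : ℤ) {x : ℝ} (hx : x ∈ dyadicRationals) :
    2 ^ k * x ∈ dyadicRationals := by
  obtain ⟨a, n, rfl⟩ := hx
  rcases Int.eq_nat_or_neg k with ⟨m, rfl | rfl⟩
  · refine ⟨2 ^ m * a, n, ?_⟩
    push_cast
    rw [zpow_natCast]
    ring
  · refine ⟨a, n + m, ?_⟩
    rw [zpow_neg, zpow_natCast, pow_add]
    field_simp

theorem countable_dyadicRationals : dyadicRationals.Countable := by
  refine (Set.countable_range fun p : ℤ × ℕ => (p.1 : ℝ) / 2 ^ p.2).mono ?_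
  rintro x ⟨a, n, rfl⟩
  exact ⟨(a, n), rfl⟩

end Dyadic

section Transitivity

theorem strictMono_of_mem_thompsonFReal {f : ℝ ≃ₜ ℝ} (hf : f ∈ thompsonFReal) :
    StrictMono f := by
  rcases f.continuous.strictMono_of_inj f.injective with h | h
  · exact h
  obtain ⟨S, hS, -, hfS⟩ := hf.1
  obtain ⟨x, hx⟩ := hS.infinite_compl.nonempty
  obtain ⟨k, b, hk⟩ := hfS x hx
  obtain ⟨y, hxy, hy⟩ := ((hk.filter_mono nhdsWithin_le_nhds).and
    (self_mem_nhdsWithin (a := x) (s := Set.Ioi x))).exists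
  have h1 := h (show x < y from hy)
  rw [hxy, hk.self_of_nhds] at h1
  have h2 := mul_lt_mul_of_pos_left (show x < y from hy) (zpow_pos (two_pos (α := ℝ)) k)
  linarith

theorem exists_affine_mem_thompsonFReal (k : ℤ) {b : ℝ} (hb : b ∈ dyadicRationals) :
    ∃ g ∈ thompsonFReal, ∀ x, g x = 2 ^ k * x + b := by
  have hk : (2 : ℝ) ^ k ≠ 0 := zpow_ne_zero k two_ne_zero
  let g : ℝ ≃ₜ ℝ := (Homeomorph.mulLeft₀ ((2 : ℝ) ^ k) hk).trans (Homeomorph.addRight b)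
  have hg : ∀ x, g x = 2 ^ k * x + b := fun x => rfl
  refine ⟨g, ⟨⟨∅, Set.finite_empty, Set.empty_subset _, fun x _ =>
    ⟨k, b, Filter.Eventually.of_forall hg⟩⟩, fun x => ⟨fun h => ?_, fun h => ?_⟩⟩, hg⟩
  · have h2 := zpow_mul_mem_dyadicRationals (-k) (sub_mem_dyadicRationals h hb)
    rwa [hg, add_sub_cancel_right, ← mul_assoc, ← zpow_add₀ two_ne_zero, neg_add_cancel,
      zpow_zero, one_mul] at h2
  · rw [hg]
    exact add_mem_dyadicRationals (zpow_mul_mem_dyadicRationals k h) hb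

theorem exists_glue_mem_thompsonFReal {f g : ℝ ≃ₜ ℝ} (hf : f ∈ thompsonFReal)
    (hg : g ∈ thompsonFReal) {b : ℝ} (hb : b ∈ dyadicRationals) (hfg : f b = g b) :
    ∃ h ∈ thompsonFReal, (∀ x ≤ b, h x = f x) ∧ ∀ x, b ≤ x → h x = g x := by
  have hfm := strictMono_of_mem_thompsonFReal hf
  have hgm := strictMono_of_mem_thompsonFReal hg
  let φ : ℝ → ℝ := fun x => if x ≤ b then f x else g x
  have h1 : ∀ x ≤ b, φ x = f x := fun x hx => if_pos hx
  have h2 : ∀ x, b ≤ x → φ x = g x := fun x hx => by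
    rcases hx.eq_or_lt with rfl | hx
    · exact (h1 _ le_rfl).trans hfg
    · exact if_neg hx.not_ge
  have hmono : StrictMono φ := by
    intro x y hxy
    rcases le_total y b with hy | hy
    · rw [h1 y hy, h1 x (hxy.le.trans hy)]
      exact hfm hxy
    rcases le_total b x with hx | hx
    · rw [h2 y hy, h2 x hx]
      exact hgm hxy
    rw [h1 x hx, h2 y hy]
    rcases hx.eq_or_lt with rfl | hx
    · rw [hfg]
      exact hgm hxy
    · exact (hfm hx).trans_le (hfg.trans_le (hgm.monotone hy))
  have hsurj : Function.Surjective φ := by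
    intro y
    rcases le_total y (f b) with hy | hy
    · refine ⟨f.symm y, ?_⟩
      rw [h1 _ (hfm.le_iff_le.1 (by rwa [f.apply_symm_apply])), f.apply_symm_apply]
    · refine ⟨g.symm y, ?_⟩
      rw [h2 _ (hgm.le_iff_le.1 (by rwa [g.apply_symm_apply, ← hfg])), g.apply_symm_apply]
  let h : ℝ ≃ₜ ℝ := (hmono.orderIsoOfSurjective φ hsurj).toHomeomorph
  have hφ : ∀ x, h x = φ x := fun x => rfl
  obtain ⟨⟨S, hS, hSd, hfS⟩, hfd⟩ := hf
  obtain ⟨⟨T, hT, hTd, hgT⟩, hgd⟩ := hg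
  refine ⟨h, ⟨⟨insert b (S ∪ T), (hS.union hT).insert b,
    Set.insert_subset hb (Set.union_subset hSd hTd), fun x hx => ?_⟩, fun x => ?_⟩, h1, h2⟩
  · simp only [Set.mem_insert_iff, Set.mem_union, not_or] at hx
    rcases lt_or_gt_of_ne hx.1 with hxb | hxb
    · obtain ⟨k, c, hk⟩ := hfS x hx.2.1
      refine ⟨k, c, ?_⟩
      filter_upwards [hk, Iio_mem_nhds hxb] with y hy hyb
      rw [hφ, h1 y (le_of_lt hyb), hy]
    · obtain ⟨k, c, hk⟩ := hgT x hx.2.2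
      refine ⟨k, c, ?_⟩
      filter_upwards [hk, Ioi_mem_nhds hxb] with y hy hyb
      rw [hφ, h2 y (le_of_lt hyb), hy]
  · rw [hφ]
    rcases le_total x b with hx | hx
    · rw [h1 x hx]
      exact hfd x
    · rw [h2 x hx]
      exact hgd x

/-- The interval `[0, 1]` is cut at `2⁻¹`, `2⁻²`, …, `2⁻ⁿ`, and each of the `n + 1` pieces is mapped
to an interval of length `1`. -/
theorem exists_mem_thompsonFReal_one_eq_natCast (n : ℕ) :
    ∃ g ∈ thompsonFReal, g 0 = 0 ∧ g 1 = (n + 1 : ℕ) := by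
  induction n with
  | zero => exact ⟨1, thompsonFReal.one_mem, rfl, by simp⟩
  | succ n ih =>
    obtain ⟨g, hg, hg0, hg1⟩ := ih
    obtain ⟨a, ha, ha'⟩ := exists_affine_mem_thompsonFReal 1
      (by simpa using intCast_mem_dyadicRationals 0)
    obtain ⟨c, hc, hc'⟩ := exists_affine_mem_thompsonFReal 1
      (intCast_mem_dyadicRationals (n : ℤ))
    have hhalf : (1 / 2 : ℝ) ∈ dyadicRationals := ⟨1, 1, by norm_num⟩
    obtain ⟨h, hh, h1, h2⟩ := exists_glue_mem_thompsonFReal (thompsonFReal.mul_mem hg ha) hc hhalf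
      (by rw [Homeomorph.mul_apply, ha', hc']; norm_num [hg1]; ring)
    refine ⟨h, hh, ?_, ?_⟩
    · rw [h1 0 (by norm_num), Homeomorph.mul_apply, ha']
      simpa using hg0
    · rw [h2 1 (by norm_num), hc']
      push_cast
      norm_num
      ring

theorem exists_mem_thompsonFReal_zero_one {a b : ℝ} (ha : a ∈ dyadicRationals)
    (hb : b ∈ dyadicRationals) (hab : a < b) : ∃ g ∈ thompsonFReal, g 0 = a ∧ g 1 = b := by
  obtain ⟨p, m, hp⟩ := sub_mem_dyadicRationals hb ha
  have hp0 : 0 < p := by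
    have h1 : (0 : ℝ) < p / 2 ^ m := hp ▸ sub_pos.2 hab
    have h2 : (0 : ℝ) < p := (div_pos_iff_of_pos_right (by positivity)).1 h1
    exact_mod_cast h2
  obtain ⟨n, rfl⟩ : ∃ n : ℕ, p = (n + 1 : ℕ) := ⟨(p - 1).toNat, by omega⟩
  obtain ⟨g, hg, hg0, hg1⟩ := exists_mem_thompsonFReal_one_eq_natCast n
  obtain ⟨c, hc, hc'⟩ := exists_affine_mem_thompsonFReal (-m) ha
  refine ⟨c * g, thompsonFReal.mul_mem hc hg, ?_, ?_⟩
  · rw [Homeomorph.mul_apply, hg0, hc']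
    simp
  · rw [Homeomorph.mul_apply, hg1, hc', ← eq_sub_iff_add_eq, hp, zpow_neg, zpow_natCast]
    push_cast
    ring

theorem exists_mem_thompsonFReal_pair {a b c d : ℝ} (ha : a ∈ dyadicRationals)
    (hb : b ∈ dyadicRationals) (hc : c ∈ dyadicRationals) (hd : d ∈ dyadicRationals)
    (hab : a < b) (hcd : c < d) : ∃ g ∈ thompsonFReal, g a = c ∧ g b = d := by
  obtain ⟨f, hf, hf0, hf1⟩ := exists_mem_thompsonFReal_zero_one ha hb hab
  obtain ⟨g, hg, hg0, hg1⟩ := exists_mem_thompsonFReal_zero_one hc hd hcd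
  refine ⟨g * f⁻¹, thompsonFReal.mul_mem hg (thompsonFReal.inv_mem hf), ?_, ?_⟩
  · change g (f.symm a) = c
    rw [← hf0, f.symm_apply_apply, hg0]
  · change g (f.symm b) = d
    rw [← hf1, f.symm_apply_apply, hg1]

theorem exists_mem_thompsonFReal_eqOn (P : Finset ℝ) (φ : ℝ → ℝ)
    (hP : ∀ x ∈ P, x ∈ dyadicRationals ∧ φ x ∈ dyadicRationals) (hφ : StrictMonoOn φ P) :
    ∃ g ∈ thompsonFReal, ∀ x ∈ P, g x = φ x := by
  induction P using Finset.induction_on_max with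
  | empty => exact ⟨1, thompsonFReal.one_mem, by simp⟩
  | insert a P ha ih =>
    obtain ⟨had, hφad⟩ := hP a (Finset.mem_insert_self a P)
    rcases P.eq_empty_or_nonempty with rfl | hne
    · obtain ⟨g, hg, hg'⟩ := exists_affine_mem_thompsonFReal 0 (sub_mem_dyadicRationals hφad had)
      refine ⟨g, hg, fun x hx => ?_⟩
      obtain rfl : x = a := by simpa using hx
      rw [hg']
      simp
    · have hsub : ∀ x ∈ P, x ∈ insert a P := fun x => Finset.mem_insert_of_mem
      obtain ⟨g, hg, hgP⟩ := ih (fun x hx => hP x (hsub x hx)) (hφ.mono hsub)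
      have hb := P.max'_mem hne
      obtain ⟨hbd, hφbd⟩ := hP _ (hsub _ hb)
      obtain ⟨h, hh, hh1, hh2⟩ := exists_mem_thompsonFReal_pair hbd had hφbd hφad (ha _ hb)
        (hφ (hsub _ hb) (Finset.mem_insert_self a P) (ha _ hb))
      obtain ⟨k, hk, hk1, hk2⟩ := exists_glue_mem_thompsonFReal hg hh hbd
        ((hgP _ hb).trans hh1.symm)
      refine ⟨k, hk, fun x hx => ?_⟩
      rcases Finset.mem_insert.1 hx with rfl | hx
      · rw [hk2 _ (ha _ hb).le, hh2]
      · rw [hk1 x (P.le_max' x hx), hgP x hx]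

theorem stronglyOrderTransitive_thompsonFReal :
    StronglyOrderTransitive thompsonFReal ((↑) : dyadicRationals → ℝ) := by
  classical
  intro P φ hφ
  let ψ : ℝ → ℝ := fun x => if h : x ∈ dyadicRationals then φ ⟨x, h⟩ else x
  have hψ : ∀ x : dyadicRationals, ψ x = φ x := fun x => dif_pos x.2
  obtain ⟨g, hg, hgP⟩ := exists_mem_thompsonFReal_eqOn (P.image (↑)) ψ
    (Finset.forall_mem_image.2 fun x _ => ⟨x.2, by rw [hψ]; exact (φ x).2⟩) (by
      intro _ hx' _ hy' hxy
      obtain ⟨x, hx, rfl⟩ := Finset.mem_image.1 hx'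
      obtain ⟨y, hy, rfl⟩ := Finset.mem_image.1 hy'
      rw [hψ, hψ]
      exact hφ x hx y hy hxy)
  exact ⟨⟨g, hg⟩, fun x hx => Subtype.ext
    ((hgP x (Finset.mem_image_of_mem _ hx)).trans (hψ x))⟩

theorem stronglyOrderTransitive_thompsonF :
    StronglyOrderTransitive thompsonF ((↑) : unitDyadicRationals → ℝ) := by
  classical
  intro P φ hφ
  let ψ : ℝ → ℝ := fun x => if h : x ∈ unitDyadicRationals then φ ⟨x, h⟩ else x
  have hψ : ∀ x : unitDyadicRationals, ψ x = φ x := fun x => dif_pos x.2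
  have hψ0 : ψ 0 = 0 := dif_neg fun h => lt_irrefl _ h.2.1
  have hψ1 : ψ 1 = 1 := dif_neg fun h => lt_irrefl _ h.2.2
  have h0 : (0 : ℝ) ∈ dyadicRationals := by simpa using intCast_mem_dyadicRationals 0
  have h1 : (1 : ℝ) ∈ dyadicRationals := by simpa using intCast_mem_dyadicRationals 1
  have hmem : ∀ x ∈ insert 0 (insert 1 (P.image (↑))), x = 0 ∨ x = 1 ∨ ∃ y ∈ P, (y : ℝ) = x :=
    fun x hx => by simpa only [Finset.mem_insert, Finset.mem_image] using hx
  obtain ⟨g, hg, hgP⟩ := exists_mem_thompsonFReal_eqOn (insert 0 (insert 1 (P.image (↑)))) ψ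
    (by
      intro x hx
      rcases hmem x hx with rfl | rfl | ⟨x, hx, rfl⟩
      · exact ⟨h0, hψ0.symm ▸ h0⟩
      · exact ⟨h1, hψ1.symm ▸ h1⟩
      · exact ⟨x.2.1, by rw [hψ]; exact (φ x).2.1⟩)
    (by
      intro x₀ hx₀ y₀ hy₀ hxy
      have hpos : ∀ z : unitDyadicRationals, (0 : ℝ) < z := fun z => z.2.2.1
      have hlt : ∀ z : unitDyadicRationals, (z : ℝ) < 1 := fun z => z.2.2.2
      rcases hmem x₀ hx₀ with rfl | rfl | ⟨x, hx, rfl⟩ <;>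
        rcases hmem y₀ hy₀ with rfl | rfl | ⟨y, hy, rfl⟩
      · exact absurd hxy (lt_irrefl _)
      · rwa [hψ0, hψ1]
      · rw [hψ0, hψ]
        exact hpos _
      · exact absurd hxy (by norm_num)
      · exact absurd hxy (lt_irrefl _)
      · exact absurd hxy (hlt y).not_gt
      · exact absurd hxy (hpos x).not_gt
      · rw [hψ1, hψ]
        exact hlt _
      · rw [hψ, hψ]
        exact hφ x hx y hy hxy)
  have hg0 : g 0 = 0 := (hgP 0 (by simp)).trans hψ0
  have hg1 : g 1 = 1 := (hgP 1 (by simp)).trans hψ1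
  obtain ⟨k, hk, hk1, hk2⟩ := exists_glue_mem_thompsonFReal thompsonFReal.one_mem hg h0 hg0.symm
  obtain ⟨l, hl, hl1, hl2⟩ := exists_glue_mem_thompsonFReal hk thompsonFReal.one_mem h1
    ((hk2 1 zero_le_one).trans hg1)
  refine ⟨⟨l, hl, fun x hx => ?_⟩, fun x hx => Subtype.ext ?_⟩
  · rw [Set.mem_Icc, not_and_or, not_le, not_le] at hx
    rcases hx with hx | hx
    · rw [hl1 x (hx.le.trans zero_le_one), hk1 x hx.le]
      rfl
    · rw [hl2 x hx.le]
      rfl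
  · change l x = φ x
    rw [hl1 x x.2.2.2.le, hk2 x x.2.2.1.le, ← hψ]
    exact hgP x (by simp [hx])

end Transitivity

/-! ### Countability of `F_ℝ` -/

section Countability

theorem exists_affine_of_locally_affine {h : ℝ → ℝ} {I : Set ℝ} (hI : IsOpen I)
    (hIp : IsPreconnected I)
    (hloc : ∀ x ∈ I, ∃ k c : ℝ, ∀ᶠ y in 𝓝 x, h y = k * y + c) :
    ∃ k c : ℝ, ∀ x ∈ I, h x = k * x + c := by
  rcases I.eq_empty_or_nonempty with rfl | ⟨x₀, hx₀⟩
  · exact ⟨0, 0, fun x hx => hx.elim⟩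
  have haff : ∀ k c x : ℝ, HasDerivAt (fun y => k * y + c) k x := fun k c x => by
    simpa using ((hasDerivAt_id x).const_mul k).add_const c
  have hd : ∀ x ∈ I, DifferentiableAt ℝ h x := fun x hx => by
    obtain ⟨k, c, hk⟩ := hloc x hx
    exact ((haff k c x).congr_of_eventuallyEq hk).differentiableAt
  have hdd : ∀ x ∈ I, HasDerivAt (deriv h) 0 x := fun x hx => by
    obtain ⟨k, c, hk⟩ := hloc x hx
    refine (hasDerivAt_const x k).congr_of_eventuallyEq ?_
    filter_upwards [eventually_eventually_nhds.2 hk] with y hy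
    exact ((haff k c y).congr_of_eventuallyEq hy).deriv
  have hconst : ∀ x ∈ I, deriv h x = deriv h x₀ := fun x hx =>
    hI.is_const_of_deriv_eq_zero hIp
      (fun x hx => (hdd x hx).differentiableAt.differentiableWithinAt)
      (fun x hx => (hdd x hx).deriv) hx hx₀
  have hder : ∀ x ∈ I, HasDerivAt (fun y => h y - deriv h x₀ * y) 0 x := fun x hx => by
    have h1 := (hd x hx).hasDerivAt
    rw [hconst x hx] at h1
    simpa using h1.fun_sub ((hasDerivAt_id x).const_mul (deriv h x₀))
  refine ⟨deriv h x₀, h x₀ - deriv h x₀ * x₀, fun x hx => ?_⟩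
  have := hI.is_const_of_deriv_eq_zero hIp
    (fun x hx => (hder x hx).differentiableAt.differentiableWithinAt)
    (fun x hx => (hder x hx).deriv) hx hx₀
  linarith

theorem eqOn_zero_of_locally_affine {h : ℝ → ℝ} (hc : Continuous h) {I : Set ℝ} (hI : IsOpen I)
    (hIp : IsPreconnected I) (hloc : ∀ x ∈ I, ∃ k c : ℝ, ∀ᶠ y in 𝓝 x, h y = k * y + c)
    {p q : ℝ} (hp : p ∈ closure I) (hq : q ∈ closure I) (hpq : p ≠ q) (hp0 : h p = 0)
    (hq0 : h q = 0) {x : ℝ} (hx : x ∈ I) : h x = 0 := by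
  obtain ⟨k, c, hk⟩ := exists_affine_of_locally_affine hI hIp hloc
  have hcl : closure I ⊆ {x | h x = k * x + c} :=
    closure_minimal hk (isClosed_eq hc (by fun_prop))
  have h1 : h p = k * p + c := hcl hp
  have h2 : h q = k * q + c := hcl hq
  have hk0 : k = 0 := by
    have h3 : k * (p - q) = 0 := by linarith
    exact (mul_eq_zero.1 h3).resolve_right (sub_ne_zero.2 hpq)
  have hc0 : c = 0 := by rw [hk0] at h1; linarith
  rw [hk x hx, hk0, hc0]
  ring

/-- A continuous function that is locally affine off a finite set `S` is determined by its values on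
`S` and, to control it on the two unbounded components, on the translates of `S` by `±1`, `±2`. -/
theorem eq_zero_of_locally_affine {h : ℝ → ℝ} (hc : Continuous h) {S : Finset ℝ} (hS : S.Nonempty)
    (hloc : ∀ x ∉ S, ∃ k c : ℝ, ∀ᶠ y in 𝓝 x, h y = k * y + c)
    (h0 : ∀ s ∈ S, ∀ i ∈ Finset.Icc (-2 : ℤ) 2, h (s + i) = 0) (x : ℝ) : h x = 0 := by
  have hS0 : ∀ s ∈ S, h s = 0 := fun s hs => by simpa using h0 s hs 0 (by simp)
  by_cases hx : x ∈ S
  · exact hS0 x hx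
  by_cases hlo : ∃ s ∈ S, s < x
  swap
  · push Not at hlo
    have hm := S.min'_mem hS
    refine eqOn_zero_of_locally_affine hc (isOpen_Iio (a := S.min' hS)) isPreconnected_Iio
      (fun y hy => hloc y fun hyS => (S.min'_le y hyS).not_gt hy)
      (p := S.min' hS + (-1 : ℤ)) (q := S.min' hS + (-2 : ℤ)) (subset_closure ?_)
      (subset_closure ?_) ?_ (h0 _ hm _ (by simp)) (h0 _ hm _ (by simp)) ?_
    · exact Set.mem_Iio.2 (by push_cast; linarith)
    · exact Set.mem_Iio.2 (by push_cast; linarith)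
    · simp
    · exact (hlo _ hm).lt_of_ne fun h => hx (h ▸ hm)
  by_cases hhi : ∃ s ∈ S, x < s
  swap
  · push Not at hhi
    have hm := S.max'_mem hS
    refine eqOn_zero_of_locally_affine hc (isOpen_Ioi (a := S.max' hS)) isPreconnected_Ioi
      (fun y hy => hloc y fun hyS => (S.le_max' y hyS).not_gt hy)
      (p := S.max' hS + (1 : ℤ)) (q := S.max' hS + (2 : ℤ)) (subset_closure ?_)
      (subset_closure ?_) ?_ (h0 _ hm _ (by simp)) (h0 _ hm _ (by simp)) ?_
    · simp
    · simp
    · simp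
    · exact (hhi _ hm).lt_of_ne fun h => hx (h ▸ hm)
  have hA : (S.filter (· < x)).Nonempty := by
    obtain ⟨s, hs, hsx⟩ := hlo
    exact ⟨s, Finset.mem_filter.2 ⟨hs, hsx⟩⟩
  have hB : (S.filter (x < ·)).Nonempty := by
    obtain ⟨s, hs, hsx⟩ := hhi
    exact ⟨s, Finset.mem_filter.2 ⟨hs, hsx⟩⟩
  obtain ⟨ha, hax⟩ := Finset.mem_filter.1 (Finset.max'_mem _ hA)
  obtain ⟨hb, hbx⟩ := Finset.mem_filter.1 (Finset.min'_mem _ hB)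
  set a := (S.filter (· < x)).max' hA
  set b := (S.filter (x < ·)).min' hB
  have hab : a < b := hax.trans hbx
  have hcl : closure (Set.Ioo a b) = Set.Icc a b := closure_Ioo hab.ne
  refine eqOn_zero_of_locally_affine hc isOpen_Ioo isPreconnected_Ioo (fun y hy => hloc y ?_)
    (hcl ▸ Set.left_mem_Icc.2 hab.le) (hcl ▸ Set.right_mem_Icc.2 hab.le) hab.ne (hS0 a ha)
    (hS0 b hb) ⟨hax, hbx⟩
  intro hyS
  rcases lt_trichotomy y x with hyx | rfl | hyx
  · exact (Finset.le_max' _ y (Finset.mem_filter.2 ⟨hyS, hyx⟩)).not_gt hy.1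
  · exact hx hyS
  · exact (Finset.min'_le _ y (Finset.mem_filter.2 ⟨hyS, hyx⟩)).not_gt hy.2

instance countable_thompsonFReal : Countable thompsonFReal := by
  classical
  have : Countable dyadicRationals := countable_dyadicRationals
  have hbreak : ∀ f : thompsonFReal, ∃ S : Finset dyadicRationals, S.Nonempty ∧
      ∀ x ∉ S.image (↑), ∃ (k : ℤ) (b : ℝ), ∀ᶠ y in 𝓝 x, f.1 y = 2 ^ k * y + b := by
    intro f
    obtain ⟨S, hS, hSd, hf⟩ := f.2.1
    have hS' : ((↑) ⁻¹' S : Set dyadicRationals).Finite := hS.preimage Subtype.val_injective.injOn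
    refine ⟨insert ⟨0, 0, 0, by simp⟩ hS'.toFinset, Finset.insert_nonempty _ _, fun x hx =>
      hf x fun hxS => hx ?_⟩
    exact Finset.mem_image.2 ⟨⟨x, hSd hxS⟩, Finset.mem_insert_of_mem (hS'.mem_toFinset.2 hxS), rfl⟩
  choose S hSne hS using hbreak
  let t : dyadicRationals → ℤ → dyadicRationals := fun s i =>
    ⟨s + i, add_mem_dyadicRationals s.2 (intCast_mem_dyadicRationals i)⟩
  -- A finite piece of the graph, large enough to determine `f` once the breakpoints are known.
  let Γ : thompsonFReal → Finset (dyadicRationals × dyadicRationals) := fun f =>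
    (S f ×ˢ Finset.Icc (-2 : ℤ) 2).image fun p => (t p.1 p.2, f • t p.1 p.2)
  refine Function.Injective.countable (f := fun f => (S f, Γ f)) fun f g hfg => ?_
  obtain ⟨hSfg, hΓ⟩ := Prod.ext_iff.1 hfg
  simp only at hSfg hΓ
  have hagree : ∀ s ∈ S f, ∀ i ∈ Finset.Icc (-2 : ℤ) 2, f.1 (s + i) = g.1 (s + i) := by
    intro s hs i hi
    have h1 : (t s i, f • t s i) ∈ Γ g :=
      hΓ ▸ Finset.mem_image_of_mem (fun p : dyadicRationals × ℤ => (t p.1 p.2, f • t p.1 p.2))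
        (Finset.mk_mem_product hs hi)
    obtain ⟨p, -, hp⟩ := Finset.mem_image.1 h1
    obtain ⟨hp1, hp2⟩ := Prod.ext_iff.1 hp
    simp only at hp1 hp2
    rw [hp1] at hp2
    exact congrArg Subtype.val hp2.symm
  refine Subtype.ext (Homeomorph.ext fun x => sub_eq_zero.1 ?_)
  refine eq_zero_of_locally_affine (h := fun x => f.1 x - g.1 x)
    (f.1.continuous.sub g.1.continuous) ((hSne f).image (↑)) (fun x hx => ?_) ?_ x
  · obtain ⟨k, b, hk⟩ := hS f x hx
    obtain ⟨l, c, hl⟩ := hS g x (hSfg ▸ hx)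
    refine ⟨2 ^ k - 2 ^ l, b - c, ?_⟩
    filter_upwards [hk, hl] with y hy1 hy2
    rw [hy1, hy2]
    ring
  · exact Finset.forall_mem_image.2 fun s hs i hi => sub_eq_zero.2 (hagree s hs i hi)

instance countable_thompsonF : Countable thompsonF :=
  Function.Injective.countable (f := fun f : thompsonF => (⟨f.1, f.2.1⟩ : thompsonFReal))
    fun _ _ h => Subtype.ext (congrArg (fun x : thompsonFReal => x.1) h)

end Countability

/-! ### Conclusion for `F` and `F_ℝ` -/

theorem isNLiouville_two_thompsonF : IsNLiouville thompsonF 2 unitDyadicRationals := by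
  have : Countable unitDyadicRationals := countable_dyadicRationals.mono Set.inter_subset_left
  refine stronglyOrderTransitive_thompsonF.isNLiouville_two Subtype.val_injective
    (ι := fun n => ⟨1 - (1 / 2) ^ (n + 1), ?_, ?_, ?_⟩) ?_
  · refine ⟨2 ^ (n + 1) - 1, n + 1, ?_⟩
    push_cast
    rw [sub_div, div_self (by positivity), div_pow, one_pow]
  · exact sub_pos.2 (pow_lt_one₀ (by norm_num) (by norm_num) n.succ_ne_zero)
  · exact sub_lt_self _ (by positivity)
  · intro m n hmn
    exact sub_lt_sub_left
      (pow_lt_pow_right_of_lt_one₀ (by norm_num) (by norm_num) (Nat.succ_lt_succ hmn)) 1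

theorem isNLiouville_two_thompsonFReal : IsNLiouville thompsonFReal 2 dyadicRationals := by
  have : Countable dyadicRationals := countable_dyadicRationals
  exact stronglyOrderTransitive_thompsonFReal.isNLiouville_two Subtype.val_injective
    (ι := fun n => ⟨n, by simpa using intCast_mem_dyadicRationals n⟩) Nat.strictMono_cast

end ThompsonLiouville

theorem mainTheorem2 :
    ThompsonLiouville.IsNLiouville ThompsonLiouville.thompsonF 2
      ThompsonLiouville.unitDyadicRationals ∧
    ThompsonLiouville.IsNLiouville ThompsonLiouville.thompsonFReal 2
      ThompsonLiouville.dyadicRationals :=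
  ⟨ThompsonLiouville.isNLiouville_two_thompsonF, ThompsonLiouville.isNLiouville_two_thompsonFReal⟩
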